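/- Let $q>0$, $q\neq 1$, and let $\alpha,\beta$ be real numbers. Write $[x]=\frac{1-q^x}{1-q}$ for $x\in\mathbb{R}$, $(x;q)_n=\prod_{i=0}^{n-1}(1-xq^i)$ for $n\in\mathbb{N}$, and $\binom{x}{k}_q=\frac{(q^{x-k+1};q)_k}{(q;q)_k}$ for $x\in\mathbb{R}$, $k\in\mathbb{N}$. For $0<q<1$ put $(x;q)_\infty=\prod_{i\ge0}(1-xq^i)$ and $(x;q)_a=(x;q)_\infty/(xq^a;q)_\infty$ for real $a$ (this agrees with the finite product when $a\in\mathbb{N}$ and $|x|<1$); where the denominator of this quotient vanishes, $1/(x;q)_a$ is read as $(xq^a;q)_\infty/(x;q)_\infty=0$. Let $\delta_x p(x)=\frac{p(qx)-p(x)}{(q-1)x}$. Let the numbers $E_{n,k}=E_{n,k}(\alpha,\beta,q)$ be given by $E_{0,0}=1$, $E_{n,k}=0$ if $k\notin\{0,\dots,n\}$, and $$E_{n,k}=q^{\beta+k-1}[n-k+\alpha]\,E_{n-1,k-1}+[k+\beta]\,E_{n-1,k}\qquad(n\ge1,\ 0\le k\le n),$$ and let $E_n(x;q)=\sum_{k=0}^nE_{n,k}x^k$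 be the bi-Stirling-Euler-Mahonian polynomials. Then the following identities hold. (i) For $n\ge1$, as polynomials in $x$, $$E_n(x;q)=\bigl([\beta]+q^\beta[n-1+\alpha]x\bigr)E_{n-1}(x;q)+(1-x)\,x\,q^\beta\,\delta_x(E_{n-1}(x;q)).$$ (ii) For $n\ge0$, $$\frac{E_n(x;q)}{(x;q)_{n+\alpha+\beta}}=\sum_{j\ge0}x^j\binom{j+\alpha+\beta-1}{j}_q[j+\beta]^n,$$ as a convergent series for all real $x$ with $|x|<1$ if $0<q<1$; and as an identity of formal power series in $x$ (for every $q>0$, $q\ne1$) if $n+\alpha+\beta\in\mathbb{N}$. (iii) $$\sum_{n\ge0}\frac{E_n(x;q)}{(x;q)_{n+\alpha+\beta}}\frac{t^n}{n!}=\sum_{j\ge0}x^j\binom{j+\alpha+\beta-1}{j}_q\exp([j+\beta]t),$$ where both series converge, to the same sum, for all real $x,t$ with $|x|<1$ if $0<q<1$; and as an identity of formal power series in $x$ and $t$ (for every $q>0$, $q\neq1$) if $\alpha+\beta\in\mathbb{N}$. (iv) For all integers $n,j\ge0$, $$\sum_{k=0}^{j}\binom{j-k+n+\alpha+\beta-1}{j-k}_qE_{n,k}=\binom{j+\alpha+\beta-1}{j}_q[j+\beta]^n.$$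 (v) For all integers $n,k\ge0$, $$E_{n,k}=\sum_{j=0}^{k}\binom{n+\alpha+\beta}{k-j}_q\binom{j+\alpha+\beta-1}{j}_q(-1)^{k-j}q^{\binom{k-j}{2}}[\beta+j]^n.$$ -/

import Mathlib

open Polynomial
open scoped Nat PowerSeries

noncomputable section

/-- The `q`-real number `[x] = (1 - q^x) / (1 - q)` (used for `q > 0`, `q ≠ 1`). -/
def qReal (q x : ℝ) : ℝ := (1 - q ^ x) / (1 - q)

/-- The finite `q`-shifted factorial `(x;q)_n = (1-x)(1-xq)⋯(1-xq^{n-1})`. -/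
def qPochFin (x q : ℝ) (n : ℕ) : ℝ := ∏ i ∈ Finset.range n, (1 - x * q ^ i)

/-- The infinite `q`-shifted factorial `(x;q)_∞ = ∏_{i ≥ 0} (1 - x q^i)` (used for `|q| < 1`). -/
def qPochInf (x q : ℝ) : ℝ := ∏' i : ℕ, (1 - x * q ^ i)

/-- The `q`-shifted factorial `(x;q)_a = (x;q)_∞ / (x q^a;q)_∞` with a real index `a`
(used for `0 < q < 1`). -/
def qPoch (x q a : ℝ) : ℝ := qPochInf x q / qPochInf (x * q ^ a) q

/-- The `q`-binomial coefficient `(q^{x-k+1};q)_k / (q;q)_k` with a real upper argument `x`. -/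
def qBinom (q x : ℝ) (k : ℕ) : ℝ := qPochFin (q ^ (x - k + 1)) q k / qPochFin q q k

/-- The numbers `E_{n,k}(α,β,q)`: `E_{0,0} = 1`, `E_{n,k} = 0` unless `0 ≤ k ≤ n`, and
`E_{n,k} = q^{β+k-1} [n-k+α] E_{n-1,k-1} + [k+β] E_{n-1,k}` for `n ≥ 1`. -/
def bsemCoeff (q α β : ℝ) : ℕ → ℕ → ℝ
  | 0, 0 => 1
  | 0, _ + 1 => 0
  | n + 1, 0 => qReal q β * bsemCoeff q α β n 0
  | n + 1, k + 1 =>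
      q ^ (β + k) * qReal q ((n : ℝ) - k + α) * bsemCoeff q α β n k
        + qReal q ((k : ℝ) + 1 + β) * bsemCoeff q α β n (k + 1)

/-- The bi-Stirling-Euler-Mahonian polynomial `E_n(x;q) = ∑_{k=0}^n E_{n,k}(α,β,q) x^k`. -/
def bsemPoly (q α β : ℝ) (n : ℕ) : ℝ[X] :=
  ∑ k ∈ Finset.range (n + 1), C (bsemCoeff q α β n k) * X ^ k

/-- The `q`-derivative `δ_x p(x) = (p(qx) - p(x)) / ((q-1) x)`; the division by `x` is `divX`. -/
def qDeriv (q : ℝ) (p : ℝ[X]) : ℝ[X] := C (q - 1)⁻¹ * (p.comp (C q * X) - p).divX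

/-- The finite `q`-shifted factorial `(x;q)_n` as a formal power series in `x`. -/
def qPochSeries (q : ℝ) (n : ℕ) : ℝ⟦X⟧ :=
  ∏ i ∈ Finset.range n, (1 - PowerSeries.C (q ^ i) * PowerSeries.X)

end

/-- The division by `(q-1) x` in `qDeriv` is exact. -/
theorem qDeriv_spec (q : ℝ) (hq : q ≠ 1) (p : ℝ[X]) :
    C (q - 1) * X * qDeriv q p = p.comp (C q * X) - p := by
  have h0 : (p.comp (C q * X) - p).coeff 0 = 0 := by
    simp [coeff_zero_eq_eval_zero, eval_comp]
  have h := X_mul_divX_add (p.comp (C q * X) - p)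
  rw [h0, C_0, add_zero] at h
  have h1 : C (q - 1) * C (q - 1)⁻¹ = (1 : ℝ[X]) := by
    rw [← C_mul, mul_inv_cancel₀ (sub_ne_zero.mpr hq), C_1]
  calc C (q - 1) * X * qDeriv q p
      = (C (q - 1) * C (q - 1)⁻¹) * (X * (p.comp (C q * X) - p).divX) := by
        unfold qDeriv; ring
    _ = p.comp (C q * X) - p := by rw [h1, one_mul, h]

/-!
Write `c_m(s) = (q^s;q)_m / (q;q)_m` (`qMultichoose`) for the coefficients of the `q`-binomial
series `1 / (x;q)_s`, so that the right-hand sides of the generating functions have coefficients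
`c_j(α + β) [j + β]^n`. Everything rests on the relation
`[m + y] c_m(s) = q^y [s - y] c_{m-1}(s + 1) + [y] c_m(s + 1)` (`qMultichoose_three_term`).
Applied with `s = n + α + β` and `y = k + β`, it shows that passing from `n` to `n + 1` in
`∑ₖ c_{j-k}(n + α + β) E_{n,k}` multiplies the sum by `[j + β]`; this is the `q`-Worpitzky identity
`sum_qMultichoose_mul_bsemCoeff`, and it says that `E_n(x;q) / (x;q)_{n + α + β}` has the
coefficients `c_j(α + β) [j + β]^n`.

The formal statements follow because the formal `q`-binomial series is inverse to `(x;q)_N` for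
natural `N` (`qPochSeries_mul_qBinomSeries`), and to the series of `(x;q)_s` for real `s`
(`qPochRealSeries_mul_qBinomSeries`); the latter gives the explicit formula for `E_{n,k}`. The
convergent statements use the `q`-binomial theorem for `|x| < 1` (`hasSum_qMultichoose_mul_pow`),
the Cauchy product with the polynomial `E_n`, and, for the exponential generating function, absolute
convergence of the double series. The `q`-derivative recurrence is the recurrence of the `E_{n,k}`
read off coefficientwise, with `[x + y] = [x] + q^x [y]`.
-/

/-! ### The formal `q`-binomial series -/

/-- The coefficient `(q^s;q)_m / (q;q)_m` of `x^m` in the `q`-binomial series `1 / (x;q)_s`, with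
the exponent `s` as parameter; it is the `q`-binomial coefficient with upper argument `m + s - 1`,
a `q`-analogue of `Nat.multichoose`. -/
noncomputable def qMultichoose (q s : ℝ) (m : ℕ) : ℝ := qPochFin (q ^ s) q m / qPochFin q q m

theorem qBinom_eq_qMultichoose (q s y : ℝ) (m : ℕ) (h : y = m + s - 1) :
    qBinom q y m = qMultichoose q s m := by
  subst h
  unfold qBinom qMultichoose
  ring_nf

theorem qPochFin_succ (x q : ℝ) (n : ℕ) :
    qPochFin x q (n + 1) = qPochFin x q n * (1 - x * q ^ n) :=
  Finset.prod_range_succ _ _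

theorem qPochFin_succ' (x q : ℝ) (n : ℕ) :
    qPochFin x q (n + 1) = (1 - x) * qPochFin (x * q) q n := by
  unfold qPochFin
  rw [Finset.prod_range_succ', mul_comm]
  simp only [pow_zero, mul_one, pow_succ', mul_assoc]

section

variable {q : ℝ}

theorem one_sub_pow_succ_ne_zero (hq0 : 0 < q) (hq1 : q ≠ 1) (n : ℕ) : 1 - q ^ (n + 1) ≠ 0 :=
  sub_ne_zero.mpr fun h => hq1 ((pow_eq_one_iff_of_nonneg hq0.le n.succ_ne_zero).mp h.symm)

theorem qPochFin_self_ne_zero (hq0 : 0 < q) (hq1 : q ≠ 1) (n : ℕ) : qPochFin q q n ≠ 0 :=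
  Finset.prod_ne_zero_iff.mpr fun i _ => by
    rw [← pow_succ']; exact one_sub_pow_succ_ne_zero hq0 hq1 i

theorem qMultichoose_zero_right (q s : ℝ) : qMultichoose q s 0 = 1 := by
  simp [qMultichoose, qPochFin]

theorem qMultichoose_zero_left (q : ℝ) (m : ℕ) : qMultichoose q 0 (m + 1) = 0 := by
  simp [qMultichoose, qPochFin_succ']

theorem qMultichoose_succ (hq0 : 0 < q) (hq1 : q ≠ 1) (s : ℝ) (m : ℕ) :
    (1 - q ^ (m + 1)) * qMultichoose q s (m + 1) = (1 - q ^ s * q ^ m) * qMultichoose q s m := by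
  have h1 := qPochFin_self_ne_zero hq0 hq1 m
  have h2 := one_sub_pow_succ_ne_zero hq0 hq1 m
  unfold qMultichoose
  rw [qPochFin_succ, qPochFin_succ, ← pow_succ']
  field_simp

theorem qMultichoose_succ' (hq0 : 0 < q) (hq1 : q ≠ 1) (s : ℝ) (m : ℕ) :
    (1 - q ^ (m + 1)) * qMultichoose q s (m + 1) = (1 - q ^ s) * qMultichoose q (s + 1) m := by
  have h1 := qPochFin_self_ne_zero hq0 hq1 m
  have h2 := one_sub_pow_succ_ne_zero hq0 hq1 m
  unfold qMultichoose
  rw [qPochFin_succ', qPochFin_succ, ← pow_succ', Real.rpow_add_one hq0.ne']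
  field_simp

/-- The three-term relation that turns the recurrence of the numbers `E_{n,k}` into
multiplication by `[m + y]`. -/
theorem qMultichoose_three_term (hq0 : 0 < q) (hq1 : q ≠ 1) (s y : ℝ) (m : ℕ) :
    qReal q ((m : ℝ) + 1 + y) * qMultichoose q s (m + 1) =
      q ^ y * qReal q (s - y) * qMultichoose q (s + 1) m
        + qReal q y * qMultichoose q (s + 1) (m + 1) := by
  have h1 : (1 : ℝ) - q ≠ 0 := sub_ne_zero.mpr hq1.symm
  have h2 := one_sub_pow_succ_ne_zero hq0 hq1 m
  have h3 := qMultichoose_succ hq0 hq1 (s + 1) m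
  have h4 := qMultichoose_succ' hq0 hq1 s m
  have e1 : q ^ ((m : ℝ) + 1 + y) = q ^ (m + 1) * q ^ y := by
    rw [Real.rpow_add hq0, ← Nat.cast_succ, Real.rpow_natCast]
  have e2 : q ^ y * q ^ (s - y) = q ^ s := by
    rw [← Real.rpow_add hq0]; ring_nf
  rw [Real.rpow_add_one hq0.ne'] at h3
  unfold qReal
  rw [e1]
  field_simp
  refine mul_left_cancel₀ h2 ?_
  linear_combination (1 - q ^ (m + 1) * q ^ y) * h4 - (1 - q ^ y) * h3
    + (1 - q ^ (m + 1)) * qMultichoose q (s + 1) m * e2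

theorem qMultichoose_sub (hq0 : 0 < q) (hq1 : q ≠ 1) (s : ℝ) (m : ℕ) :
    qMultichoose q (s + 1) (m + 1) - q ^ s * qMultichoose q (s + 1) m =
      qMultichoose q s (m + 1) := by
  have h2 := one_sub_pow_succ_ne_zero hq0 hq1 m
  have h3 := qMultichoose_succ hq0 hq1 (s + 1) m
  have h4 := qMultichoose_succ' hq0 hq1 s m
  rw [Real.rpow_add_one hq0.ne'] at h3
  refine mul_left_cancel₀ h2 ?_
  linear_combination h3 - h4

/-- The formal `q`-binomial series `∑ₘ (q^s;q)_m / (q;q)_m x^m`, that is `1 / (x;q)_s`. -/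
noncomputable def qBinomSeries (q s : ℝ) : ℝ⟦X⟧ := PowerSeries.mk (qMultichoose q s)

theorem one_sub_C_mul_X_mul_qBinomSeries (hq0 : 0 < q) (hq1 : q ≠ 1) (s : ℝ) :
    (1 - PowerSeries.C (q ^ s) * PowerSeries.X) * qBinomSeries q (s + 1) = qBinomSeries q s := by
  ext m
  rw [sub_mul, one_mul, map_sub, mul_assoc, PowerSeries.coeff_C_mul]
  cases m with
  | zero => simp [qBinomSeries, qMultichoose_zero_right]
  | succ m =>
    rw [PowerSeries.coeff_succ_X_mul]
    simp only [qBinomSeries, PowerSeries.coeff_mk]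
    exact qMultichoose_sub hq0 hq1 s m

theorem qPochSeries_mul_qBinomSeries (hq0 : 0 < q) (hq1 : q ≠ 1) (N : ℕ) :
    qPochSeries q N * qBinomSeries q N = 1 := by
  induction N with
  | zero =>
    ext m
    cases m with
    | zero => simp [qPochSeries, qBinomSeries, qMultichoose_zero_right]
    | succ m => simp [qPochSeries, qBinomSeries, qMultichoose_zero_left, PowerSeries.coeff_one]
  | succ N ih =>
    have h := one_sub_C_mul_X_mul_qBinomSeries hq0 hq1 (N : ℝ)
    rw [Real.rpow_natCast] at h
    rw [qPochSeries, Finset.prod_range_succ, mul_assoc, Nat.cast_succ, h]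
    exact ih

theorem qPochSeries_inv (hq0 : 0 < q) (hq1 : q ≠ 1) (N : ℕ) :
    (qPochSeries q N)⁻¹ = qBinomSeries q N := by
  have h : PowerSeries.constantCoeff (qPochSeries q N) ≠ 0 := by
    simp [qPochSeries, map_prod]
  rw [eq_comm, PowerSeries.eq_inv_iff_mul_eq_one h, mul_comm]
  exact qPochSeries_mul_qBinomSeries hq0 hq1 N

/-- The formal power series of `(x;q)_s` for a real index `s`. -/
noncomputable def qPochRealSeries (q s : ℝ) : ℝ⟦X⟧ :=
  PowerSeries.mk fun j => qBinom q s j * (-1) ^ j * q ^ (j.choose 2)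

theorem coeff_qPochRealSeries_succ (hq0 : 0 < q) (hq1 : q ≠ 1) (s : ℝ) (m : ℕ) :
    (1 - q ^ (m + 1)) * PowerSeries.coeff (m + 1) (qPochRealSeries q s) =
      (q ^ s - q ^ m) * PowerSeries.coeff m (qPochRealSeries q s) := by
  have h1 := qPochFin_self_ne_zero hq0 hq1 m
  have h2 := one_sub_pow_succ_ne_zero hq0 hq1 m
  have e1 : s - ((m + 1 : ℕ) : ℝ) + 1 = s - m := by push_cast; ring
  have e2 : q ^ (s - m) * q ^ m = q ^ s := by
    rw [← Real.rpow_natCast, ← Real.rpow_add hq0]; ring_nf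
  simp only [qPochRealSeries, PowerSeries.coeff_mk, qBinom]
  rw [qPochFin_succ', qPochFin_succ q q m, ← pow_succ' q m, e1, ← Real.rpow_add_one hq0.ne',
    Nat.choose_succ_succ' m 1, Nat.choose_one_right, pow_add q m (m.choose _), pow_succ (-1 : ℝ) m]
  -- kept opaque, so that normalization of `q ^ (m + 1)` does not hide the cancellation
  generalize 1 - q ^ (m + 1) = d at h2 ⊢
  field_simp
  linear_combination qPochFin (q ^ (s - m + 1)) q m * e2

/-- Both `q`-binomial series satisfy a first order functional equation relating `x` and `q x`;
their product is invariant under `x ↦ q x`, hence constant. -/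
theorem qPochRealSeries_mul_qBinomSeries (hq0 : 0 < q) (hq1 : q ≠ 1) (s : ℝ) :
    qPochRealSeries q s * qBinomSeries q s = 1 := by
  have hG : (1 - PowerSeries.X) * qBinomSeries q s =
      (1 - PowerSeries.C (q ^ s) * PowerSeries.X) * PowerSeries.rescale q (qBinomSeries q s) := by
    ext m
    rw [sub_mul, sub_mul, one_mul, one_mul, map_sub, map_sub, mul_assoc, PowerSeries.coeff_C_mul]
    cases m with
    | zero => simp
    | succ m =>
      rw [PowerSeries.coeff_succ_X_mul, PowerSeries.coeff_succ_X_mul, PowerSeries.coeff_rescale,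
        PowerSeries.coeff_rescale]
      simp only [qBinomSeries, PowerSeries.coeff_mk]
      linear_combination qMultichoose_succ hq0 hq1 s m
  have hB : (1 - PowerSeries.C (q ^ s) * PowerSeries.X) * qPochRealSeries q s =
      (1 - PowerSeries.X) * PowerSeries.rescale q (qPochRealSeries q s) := by
    ext m
    rw [sub_mul, sub_mul, one_mul, one_mul, map_sub, map_sub, mul_assoc, PowerSeries.coeff_C_mul]
    cases m with
    | zero => simp
    | succ m =>
      rw [PowerSeries.coeff_succ_X_mul, PowerSeries.coeff_succ_X_mul, PowerSeries.coeff_rescale,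
        PowerSeries.coeff_rescale]
      linear_combination coeff_qPochRealSeries_succ hq0 hq1 s m
  have hne (c : ℝ) : (1 - PowerSeries.C c * PowerSeries.X : ℝ⟦X⟧) ≠ 0 := fun h => by
    simpa using congrArg PowerSeries.constantCoeff h
  have hne1 : (1 - PowerSeries.X : ℝ⟦X⟧) ≠ 0 := by simpa using hne 1
  have hP : qPochRealSeries q s * qBinomSeries q s =
      PowerSeries.rescale q (qPochRealSeries q s * qBinomSeries q s) := by
    rw [map_mul]
    refine mul_left_cancel₀ (mul_ne_zero (hne (q ^ s)) hne1) ?_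
    calc _ = ((1 - PowerSeries.C (q ^ s) * PowerSeries.X) * qPochRealSeries q s) *
          ((1 - PowerSeries.X) * qBinomSeries q s) := by ring
      _ = _ := by rw [hG, hB]; ring
  ext m
  cases m with
  | zero => simp [PowerSeries.coeff_mul, qPochRealSeries, qBinomSeries, qMultichoose_zero_right,
      qBinom, qPochFin]
  | succ m =>
    have h := congrArg (PowerSeries.coeff (m + 1)) hP
    rw [PowerSeries.coeff_rescale] at h
    rw [PowerSeries.coeff_one, if_neg m.succ_ne_zero]
    refine (mul_eq_zero.mp ?_).resolve_left (one_sub_pow_succ_ne_zero hq0 hq1 m)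
    linear_combination h

end

/-! ### The numbers `E_{n,k}` and the `q`-Worpitzky identity -/

section

variable {q : ℝ}

theorem bsemCoeff_eq_zero (q α β : ℝ) {n k : ℕ} (h : n < k) : bsemCoeff q α β n k = 0 := by
  induction n generalizing k with
  | zero => obtain ⟨k, rfl⟩ := Nat.exists_eq_succ_of_ne_zero h.ne'; rfl
  | succ n ih =>
    obtain ⟨k, rfl⟩ := Nat.exists_eq_succ_of_ne_zero (Nat.ne_zero_of_lt h)
    rw [Nat.succ_eq_add_one, bsemCoeff, ih (by lia), ih (by lia), mul_zero, mul_zero, add_zero]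

theorem coeff_bsemPoly (q α β : ℝ) (n k : ℕ) :
    (bsemPoly q α β n).coeff k = bsemCoeff q α β n k := by
  simp only [bsemPoly, finsetSum_coeff, coeff_C_mul_X_pow, Finset.sum_ite_eq, Finset.mem_range]
  split_ifs with h
  · rfl
  · exact (bsemCoeff_eq_zero q α β (by lia)).symm

theorem coeff_qDeriv (q : ℝ) (p : ℝ[X]) (k : ℕ) :
    (qDeriv q p).coeff k = qReal q (k + 1) * p.coeff (k + 1) := by
  have h : q ^ ((k : ℝ) + 1) = q ^ (k + 1) := by rw [← Nat.cast_succ, Real.rpow_natCast]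
  rw [qDeriv, coeff_C_mul, coeff_divX, coeff_sub, comp_C_mul_X_coeff, qReal, h, div_eq_mul_inv,
    ← neg_sub q 1, inv_neg]
  ring

theorem qReal_add (hq0 : 0 < q) (x y : ℝ) : qReal q (x + y) = qReal q x + q ^ x * qReal q y := by
  unfold qReal
  rw [Real.rpow_add hq0]
  ring

theorem bsemPoly_succ (hq0 : 0 < q) (α β : ℝ) (n : ℕ) :
    bsemPoly q α β (n + 1) =
      (C (qReal q β) + C (q ^ β * qReal q ((n : ℝ) + α)) * X) * bsemPoly q α β n
        + (1 - X) * X * C (q ^ β) * qDeriv q (bsemPoly q α β n) := by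
  have e : (C (qReal q β) + C (q ^ β * qReal q ((n : ℝ) + α)) * X) * bsemPoly q α β n
        + (1 - X) * X * C (q ^ β) * qDeriv q (bsemPoly q α β n) =
      C (qReal q β) * bsemPoly q α β n
        + X * (C (q ^ β * qReal q ((n : ℝ) + α)) * bsemPoly q α β n
          + C (q ^ β) * qDeriv q (bsemPoly q α β n)
          - C (q ^ β) * (X * qDeriv q (bsemPoly q α β n))) := by ring
  rw [e]
  ext k
  cases k with
  | zero => simp only [coeff_add, coeff_C_mul, coeff_X_mul_zero, coeff_bsemPoly, bsemCoeff,
      add_zero]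
  | succ k =>
    -- also at `k = 0`, because `[0] = 0`
    have hX : (X * qDeriv q (bsemPoly q α β n)).coeff k = qReal q k * bsemCoeff q α β n k := by
      cases k with
      | zero => simp [qReal]
      | succ k => rw [coeff_X_mul, coeff_qDeriv, coeff_bsemPoly, Nat.cast_succ]
    have h1 : qReal q ((k : ℝ) + 1 + β) = qReal q β + q ^ β * qReal q ((k : ℝ) + 1) := by
      rw [add_comm, qReal_add hq0]
    have h2 : qReal q ((n : ℝ) + α) = qReal q k + q ^ (k : ℝ) * qReal q ((n : ℝ) - k + α) := by
      rw [← qReal_add hq0]; ring_nf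
    rw [coeff_add, coeff_C_mul, coeff_X_mul, coeff_sub, coeff_add, coeff_C_mul, coeff_C_mul,
      coeff_C_mul, hX, coeff_qDeriv]
    simp only [coeff_bsemPoly, bsemCoeff]
    rw [h1, h2, Real.rpow_add hq0]
    ring

/-- The `q`-Worpitzky identity: by the three-term relation, each step of the recurrence multiplies
the left-hand side by `[j + β]`. -/
theorem sum_qMultichoose_mul_bsemCoeff (hq0 : 0 < q) (hq1 : q ≠ 1) (α β : ℝ) (n j : ℕ) :
    ∑ k ∈ Finset.range (j + 1),
        qMultichoose q ((n : ℝ) + α + β) (j - k) * bsemCoeff q α β n k =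
      qMultichoose q (α + β) j * qReal q ((j : ℝ) + β) ^ n := by
  induction n with
  | zero =>
    rw [Finset.sum_range_succ', Finset.sum_eq_zero fun k _ => by rw [bsemCoeff, mul_zero]]
    simp [bsemCoeff]
  | succ n ih =>
    rw [pow_succ', mul_left_comm, ← ih, Finset.mul_sum, Nat.cast_succ,
      show (n : ℝ) + 1 + α + β = (n + α + β) + 1 by ring]
    generalize hs : (n : ℝ) + α + β = s
    -- collect the two contributions of each `E_{n,k}` to the sum for `n + 1`
    have hL : ∑ k ∈ Finset.range (j + 1),
          qMultichoose q (s + 1) (j - k) * bsemCoeff q α β (n + 1) k =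
        ∑ k ∈ Finset.range (j + 1),
          qReal q ((k : ℝ) + β) * qMultichoose q (s + 1) (j - k) * bsemCoeff q α β n k +
        ∑ k ∈ Finset.range j, q ^ (β + k) * qReal q (s - (β + k)) *
          qMultichoose q (s + 1) (j - (k + 1)) * bsemCoeff q α β n k := by
      rw [Finset.sum_range_succ', Finset.sum_range_succ' _ j, add_right_comm,
        ← Finset.sum_add_distrib]
      congr 1
      · refine Finset.sum_congr rfl fun k _ => ?_
        rw [bsemCoeff, ← hs, show (n : ℝ) + α + β - (β + k) = n - k + α by ring]
        push_cast
        ring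
      · rw [bsemCoeff, Nat.cast_zero, zero_add]
        ring
    rw [hL, Finset.sum_range_succ, Finset.sum_range_succ _ j, add_right_comm,
      ← Finset.sum_add_distrib]
    congr 1
    · refine Finset.sum_congr rfl fun k hk => ?_
      obtain ⟨m, rfl⟩ := Nat.exists_eq_add_of_lt (Finset.mem_range.mp hk)
      have h := qMultichoose_three_term hq0 hq1 s (β + k) m
      rw [show k + m + 1 - (k + 1) = m by lia, show k + m + 1 - k = m + 1 by lia]
      rw [show ((k + m + 1 : ℕ) : ℝ) + β = m + 1 + (β + k) by push_cast; ring, add_comm (k : ℝ) β]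
      linear_combination -bsemCoeff q α β n k * h
    · simp only [Nat.sub_self, qMultichoose_zero_right]
      ring

/-- The `q`-Worpitzky identity, for generating functions. -/
theorem bsemPoly_mul_qBinomSeries (hq0 : 0 < q) (hq1 : q ≠ 1) (α β : ℝ) (n : ℕ) :
    (bsemPoly q α β n : ℝ⟦X⟧) * qBinomSeries q ((n : ℝ) + α + β) =
      PowerSeries.mk fun j : ℕ => qMultichoose q (α + β) j * qReal q ((j : ℝ) + β) ^ n := by
  ext j
  rw [PowerSeries.coeff_mul, Finset.Nat.sum_antidiagonal_eq_sum_range_succ_mk,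
    PowerSeries.coeff_mk, ← sum_qMultichoose_mul_bsemCoeff hq0 hq1 α β n j]
  refine Finset.sum_congr rfl fun k _ => ?_
  rw [Polynomial.coeff_coe, coeff_bsemPoly, qBinomSeries, PowerSeries.coeff_mk, mul_comm]

theorem bsemCoeff_eq_sum (hq0 : 0 < q) (hq1 : q ≠ 1) (α β : ℝ) (n k : ℕ) :
    bsemCoeff q α β n k =
      ∑ j ∈ Finset.range (k + 1), qMultichoose q (α + β) j * qReal q ((j : ℝ) + β) ^ n *
        (qBinom q ((n : ℝ) + α + β) (k - j) * (-1) ^ (k - j) * q ^ ((k - j).choose 2)) := by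
  have h : (bsemPoly q α β n : ℝ⟦X⟧) =
      (PowerSeries.mk fun j : ℕ => qMultichoose q (α + β) j * qReal q ((j : ℝ) + β) ^ n) *
        qPochRealSeries q ((n : ℝ) + α + β) := by
    rw [← bsemPoly_mul_qBinomSeries hq0 hq1, mul_assoc, mul_comm (qBinomSeries _ _),
      qPochRealSeries_mul_qBinomSeries hq0 hq1, mul_one]
  have hk := congrArg (PowerSeries.coeff k) h
  rw [Polynomial.coeff_coe, coeff_bsemPoly, PowerSeries.coeff_mul,
    Finset.Nat.sum_antidiagonal_eq_sum_range_succ_mk] at hk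
  simpa only [PowerSeries.coeff_mk, qPochRealSeries] using hk

end

/-! ### Convergence of the `q`-binomial series -/

section

open Filter Topology

variable {q : ℝ}

theorem summable_norm_neg_mul_pow (hq0 : 0 < q) (hq : q < 1) (x : ℝ) :
    Summable fun i : ℕ => ‖-(x * q ^ i)‖ := by
  simp only [norm_neg, norm_mul, norm_pow]
  refine (summable_geometric_of_lt_one (norm_nonneg q) ?_).mul_left _
  rwa [Real.norm_of_nonneg hq0.le]

theorem tendsto_qPochFin (hq0 : 0 < q) (hq : q < 1) (x : ℝ) :
    Tendsto (qPochFin x q) atTop (𝓝 (qPochInf x q)) := by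
  have h := (multipliable_one_add_of_summable
    (summable_norm_neg_mul_pow hq0 hq x)).hasProd.tendsto_prod_nat
  simp only [← sub_eq_add_neg] at h
  exact h

theorem qPochInf_ne_zero (hq0 : 0 < q) (hq : q < 1) {x : ℝ} (hx : |x| < 1) :
    qPochInf x q ≠ 0 := by
  have h := tprod_one_add_ne_zero_of_summable (f := fun i : ℕ => -(x * q ^ i)) (fun i => ?_)
    (summable_norm_neg_mul_pow hq0 hq x)
  · simp only [← sub_eq_add_neg] at h
    exact h
  · rw [← sub_eq_add_neg]
    refine (sub_pos.mpr ?_).ne'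
    calc x * q ^ i ≤ |x| * q ^ i := by gcongr; exact le_abs_self x
      _ ≤ |x| := mul_le_of_le_one_right (abs_nonneg x) (pow_le_one₀ hq0.le hq.le)
      _ < 1 := hx

/-- The coefficients of the `q`-binomial series converge, to `(q^s;q)_∞ / (q;q)_∞`, so they are
bounded. -/
theorem exists_abs_qMultichoose_le (hq0 : 0 < q) (hq : q < 1) (s : ℝ) :
    ∃ K, ∀ m, |qMultichoose q s m| ≤ K := by
  have hq' : |q| < 1 := by rwa [abs_of_pos hq0]
  obtain ⟨K, hK⟩ := ((tendsto_qPochFin hq0 hq (q ^ s)).div (tendsto_qPochFin hq0 hq q)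
    (qPochInf_ne_zero hq0 hq hq')).abs.bddAbove_range
  exact ⟨K, fun m => hK ⟨m, rfl⟩⟩

theorem summable_norm_qMultichoose_mul_pow (hq0 : 0 < q) (hq : q < 1) (s : ℝ) {x : ℝ}
    (hx : |x| < 1) : Summable fun m : ℕ => ‖qMultichoose q s m * x ^ m‖ := by
  obtain ⟨K, hK⟩ := exists_abs_qMultichoose_le hq0 hq s
  refine Summable.of_nonneg_of_le (fun _ => norm_nonneg _) (fun m => ?_)
    ((summable_geometric_of_lt_one (abs_nonneg x) hx).mul_left K)
  rw [norm_mul, norm_pow, Real.norm_eq_abs, Real.norm_eq_abs]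
  exact mul_le_mul_of_nonneg_right (hK m) (by positivity)

theorem abs_mul_pow_lt_one (hq0 : 0 < q) (hq : q < 1) {x : ℝ} (hx : |x| < 1) (N : ℕ) :
    |x * q ^ N| < 1 := by
  rw [abs_mul, abs_pow, abs_of_pos hq0]
  exact (mul_le_of_le_one_right (abs_nonneg x) (pow_le_one₀ hq0.le hq.le)).trans_lt hx

theorem one_sub_mul_tsum_qMultichoose (hq0 : 0 < q) (hq : q < 1) (s : ℝ) {x : ℝ} (hx : |x| < 1) :
    (1 - x) * ∑' m : ℕ, qMultichoose q s m * x ^ m =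
      (1 - x * q ^ s) * ∑' m : ℕ, qMultichoose q s m * (x * q) ^ m := by
  have hxq : |x * q| < 1 := by simpa using abs_mul_pow_lt_one hq0 hq hx 1
  have h1 := (summable_norm_qMultichoose_mul_pow hq0 hq s hx).of_norm
  have h2 := (summable_norm_qMultichoose_mul_pow hq0 hq s hxq).of_norm
  have h3 : ∑' m : ℕ, (qMultichoose q s m * x ^ m - qMultichoose q s m * (x * q) ^ m) =
      ∑' m : ℕ, (x * (qMultichoose q s m * x ^ m)
        - x * q ^ s * (qMultichoose q s m * (x * q) ^ m)) := by
    rw [(h1.sub h2).tsum_eq_zero_add, pow_zero, pow_zero, sub_self, zero_add]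
    refine tsum_congr fun m => ?_
    rw [mul_pow, mul_pow]
    linear_combination x ^ (m + 1) * qMultichoose_succ hq0 hq.ne s m
  rw [h1.tsum_sub h2, (h1.mul_left x).tsum_sub (h2.mul_left _), tsum_mul_left,
    tsum_mul_left] at h3
  linear_combination h3

theorem qPochFin_mul_tsum_qMultichoose (hq0 : 0 < q) (hq : q < 1) (s : ℝ) {x : ℝ} (hx : |x| < 1)
    (N : ℕ) :
    qPochFin x q N * ∑' m : ℕ, qMultichoose q s m * x ^ m =
      qPochFin (x * q ^ s) q N * ∑' m : ℕ, qMultichoose q s m * (x * q ^ N) ^ m := by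
  induction N with
  | zero => simp [qPochFin]
  | succ N ih =>
    have h := one_sub_mul_tsum_qMultichoose hq0 hq s (abs_mul_pow_lt_one hq0 hq hx N)
    rw [mul_assoc x (q ^ N) q, ← pow_succ] at h
    rw [qPochFin_succ, qPochFin_succ]
    linear_combination (1 - x * q ^ N) * ih + qPochFin (x * q ^ s) q N * h

/-- The `q`-binomial theorem, obtained by iterating the functional equation between `x` and
`x q`. The value `(qPoch x q s)⁻¹` is `(x q^s;q)_∞ / (x;q)_∞` also where `(x q^s;q)_∞ = 0`. -/
theorem hasSum_qMultichoose_mul_pow (hq0 : 0 < q) (hq : q < 1) (s : ℝ) {x : ℝ} (hx : |x| < 1) :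
    HasSum (fun m : ℕ => qMultichoose q s m * x ^ m) (qPoch x q s)⁻¹ := by
  have hsum := summable_norm_qMultichoose_mul_pow hq0 hq s hx
  have hlim : Tendsto (fun N : ℕ => ∑' m : ℕ, qMultichoose q s m * (x * q ^ N) ^ m) atTop
      (𝓝 (∑' m : ℕ, qMultichoose q s m * (0 : ℝ) ^ m)) := by
    refine tendsto_tsum_of_dominated_convergence hsum (fun m => ?_) (.of_forall fun N m => ?_)
    · have h := (tendsto_pow_atTop_nhds_zero_of_lt_one hq0.le hq).const_mul x
      rw [mul_zero] at h
      exact (h.pow m).const_mul _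
    · rw [norm_mul, norm_mul, norm_pow, norm_pow]
      gcongr
      rw [norm_mul, norm_pow, Real.norm_of_nonneg hq0.le]
      exact mul_le_of_le_one_right (norm_nonneg x) (pow_le_one₀ hq0.le hq.le)
  have hone : ∑' m : ℕ, qMultichoose q s m * (0 : ℝ) ^ m = 1 := by
    rw [tsum_eq_single 0 fun m hm => by rw [zero_pow hm, mul_zero], qMultichoose_zero_right,
      pow_zero, mul_one]
  rw [hone] at hlim
  have h := tendsto_nhds_unique ((tendsto_qPochFin hq0 hq x).mul_const
    (∑' m : ℕ, qMultichoose q s m * x ^ m))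
    (((tendsto_qPochFin hq0 hq (x * q ^ s)).mul hlim).congr fun N =>
      (qPochFin_mul_tsum_qMultichoose hq0 hq s hx N).symm)
  have he : ∑' m : ℕ, qMultichoose q s m * x ^ m = (qPoch x q s)⁻¹ := by
    rw [qPoch, inv_div, eq_div_iff (qPochInf_ne_zero hq0 hq hx), mul_comm, h, mul_one]
  exact he ▸ hsum.of_norm.hasSum

/-! ### Convergent generating functions -/

theorem hasSum_qMultichoose_mul_qReal_pow (hq0 : 0 < q) (hq : q < 1) (α β : ℝ) (n : ℕ) {x : ℝ}
    (hx : |x| < 1) :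
    HasSum (fun j : ℕ => x ^ j * qMultichoose q (α + β) j * qReal q ((j : ℝ) + β) ^ n)
      ((bsemPoly q α β n).eval x / qPoch x q ((n : ℝ) + α + β)) := by
  have hE0 : ∀ k ∉ Finset.range (n + 1), bsemCoeff q α β n k * x ^ k = 0 := fun k hk => by
    rw [bsemCoeff_eq_zero q α β (by simpa using hk), zero_mul]
  have hE : ∑' k : ℕ, bsemCoeff q α β n k * x ^ k = (bsemPoly q α β n).eval x := by
    rw [tsum_eq_sum hE0, bsemPoly, eval_finsetSum]
    simp only [eval_mul, eval_C, eval_pow, eval_X]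
  have hEs : Summable fun k : ℕ => ‖bsemCoeff q α β n k * x ^ k‖ :=
    summable_of_ne_finset_zero fun k hk => by rw [hE0 k hk, norm_zero]
  have h := hasSum_sum_range_mul_of_summable_norm hEs
    (summable_norm_qMultichoose_mul_pow hq0 hq ((n : ℝ) + α + β) hx)
  rw [hE, (hasSum_qMultichoose_mul_pow hq0 hq _ hx).tsum_eq, ← div_eq_mul_inv] at h
  refine h.congr_fun fun j => ?_
  rw [mul_assoc, ← sum_qMultichoose_mul_bsemCoeff hq0 hq.ne α β n j, Finset.mul_sum]
  refine Finset.sum_congr rfl fun k hk => ?_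
  rw [← Nat.add_sub_of_le (Finset.mem_range_succ_iff.mp hk), pow_add, Nat.add_sub_cancel_left]
  ring

theorem abs_qReal_add_le (hq0 : 0 < q) (hq : q < 1) (β : ℝ) (j : ℕ) :
    |qReal q ((j : ℝ) + β)| ≤ (1 + q ^ β) / (1 - q) := by
  have h1 : 0 < 1 - q := sub_pos.mpr hq
  have h2 : q ^ ((j : ℝ) + β) ≤ q ^ β :=
    Real.rpow_le_rpow_of_exponent_ge hq0 hq.le (le_add_of_nonneg_left j.cast_nonneg)
  have h3 : 0 < q ^ ((j : ℝ) + β) := Real.rpow_pos_of_pos hq0 _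
  rw [qReal, abs_div, abs_of_pos h1]
  gcongr
  rw [abs_le]
  constructor <;> linarith

/-- The exponential generating function: the double series over `n` and `j` converges absolutely,
because the numbers `[j + β]` are bounded, and can be summed in either order. -/
theorem exists_hasSum_exp_generating (hq0 : 0 < q) (hq : q < 1) (α β : ℝ) {x : ℝ} (t : ℝ)
    (hx : |x| < 1) : ∃ S : ℝ,
      HasSum (fun n : ℕ =>
        (bsemPoly q α β n).eval x / qPoch x q ((n : ℝ) + α + β) * (t ^ n / (n ! : ℝ))) S ∧
      HasSum (fun j : ℕ =>
        x ^ j * qMultichoose q (α + β) j * Real.exp (qReal q ((j : ℝ) + β) * t)) S := by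
  set M := (1 + q ^ β) / (1 - q)
  let f : ℕ × ℕ → ℝ := fun p =>
    x ^ p.2 * qMultichoose q (α + β) p.2 * qReal q ((p.2 : ℝ) + β) ^ p.1 * (t ^ p.1 / (p.1 ! : ℝ))
  have hf : Summable f := by
    refine Summable.of_norm_bounded ((Real.summable_pow_div_factorial (M * |t|)).mul_of_nonneg
      (summable_norm_qMultichoose_mul_pow hq0 hq (α + β) hx) (fun n => ?_)
      fun _ => norm_nonneg _) fun p => ?_
    · have hM : 0 ≤ M := (abs_nonneg _).trans (abs_qReal_add_le hq0 hq β 0)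
      positivity
    · have h := pow_le_pow_left₀ (abs_nonneg _) (abs_qReal_add_le hq0 hq β p.2) p.1
      have hn : ‖f p‖ = |qReal q ((p.2 : ℝ) + β)| ^ p.1 * (|t| ^ p.1 / (p.1 ! : ℝ)) *
          ‖qMultichoose q (α + β) p.2 * x ^ p.2‖ := by
        simp only [f, Real.norm_eq_abs, abs_mul, abs_div, abs_pow, Nat.abs_cast]
        ring
      rw [hn, mul_pow, mul_div_assoc]
      gcongr
  refine ⟨∑' p, f p, hf.hasSum.prod_fiberwise fun n => ?_,
    ((Equiv.prodComm ℕ ℕ).hasSum_iff.mpr hf.hasSum).prod_fiberwise fun j => ?_⟩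
  · exact (hasSum_qMultichoose_mul_qReal_pow hq0 hq α β n hx).mul_right _
  · have h := (NormedSpace.expSeries_div_hasSum_exp (qReal q ((j : ℝ) + β) * t)).mul_left
      (x ^ j * qMultichoose q (α + β) j)
    rw [← Real.exp_eq_exp_ℝ] at h
    refine h.congr_fun fun n => ?_
    simp only [f, Function.comp_apply, Equiv.prodComm_apply, Prod.swap_prod_mk]
    ring

end

/-! ### The identities -/

theorem theorem2 (q α β : ℝ) (hq0 : 0 < q) (hq1 : q ≠ 1) :
    -- (i) the `q`-derivative recurrence
    (∀ n : ℕ, 1 ≤ n →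
      bsemPoly q α β n =
        (C (qReal q β) + C (q ^ β * qReal q ((n : ℝ) - 1 + α)) * X) * bsemPoly q α β (n - 1)
          + (1 - X) * X * C (q ^ β) * qDeriv q (bsemPoly q α β (n - 1))) ∧
    -- (ii) the Carlitz-type series, as a convergent series
    (q < 1 → ∀ (n : ℕ) (x : ℝ), |x| < 1 →
      HasSum (fun j : ℕ => x ^ j * qBinom q ((j : ℝ) + α + β - 1) j * qReal q ((j : ℝ) + β) ^ n)
        ((bsemPoly q α β n).eval x / qPoch x q ((n : ℝ) + α + β))) ∧
    -- (ii) as an identity of formal power series in `x`, when the index is a natural number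
    (∀ n N : ℕ, (N : ℝ) = (n : ℝ) + α + β →
      (bsemPoly q α β n : ℝ⟦X⟧) * (qPochSeries q N)⁻¹ =
        PowerSeries.mk fun j : ℕ =>
          qBinom q ((j : ℝ) + α + β - 1) j * qReal q ((j : ℝ) + β) ^ n) ∧
    -- (iii) the exponential generating function, as convergent series with the same sum
    (q < 1 → ∀ x t : ℝ, |x| < 1 → ∃ S : ℝ,
      HasSum (fun n : ℕ =>
        (bsemPoly q α β n).eval x / qPoch x q ((n : ℝ) + α + β) * (t ^ n / (n ! : ℝ))) S ∧
      HasSum (fun j : ℕ =>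
        x ^ j * qBinom q ((j : ℝ) + α + β - 1) j * Real.exp (qReal q ((j : ℝ) + β) * t)) S) ∧
    -- (iii) as an identity of formal power series in `x` and `t`: for every `j`, the
    -- coefficients of `x ^ j` on the two sides agree as formal power series in `t`
    (∀ m : ℕ, (m : ℝ) = α + β → ∀ j : ℕ,
      (PowerSeries.mk fun n : ℕ =>
          PowerSeries.coeff j ((bsemPoly q α β n : ℝ⟦X⟧) * (qPochSeries q (n + m))⁻¹)
            / (n ! : ℝ)) =
        PowerSeries.C (qBinom q ((j : ℝ) + α + β - 1) j) *
          PowerSeries.rescale (qReal q ((j : ℝ) + β)) (PowerSeries.exp ℝ)) ∧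
    -- (iv) the `q`-Worpitzky identity
    (∀ n j : ℕ,
      ∑ k ∈ Finset.range (j + 1),
          qBinom q ((j : ℝ) - k + n + α + β - 1) (j - k) * bsemCoeff q α β n k =
        qBinom q ((j : ℝ) + α + β - 1) j * qReal q ((j : ℝ) + β) ^ n) ∧
    -- (v) the explicit formula
    (∀ n k : ℕ,
      bsemCoeff q α β n k =
        ∑ j ∈ Finset.range (k + 1),
          qBinom q ((n : ℝ) + α + β) (k - j) * qBinom q ((j : ℝ) + α + β - 1) j *
            (-1) ^ (k - j) * q ^ ((k - j).choose 2) * qReal q (β + j) ^ n) := by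
  have hB (j : ℕ) : qBinom q ((j : ℝ) + α + β - 1) j = qMultichoose q (α + β) j :=
    qBinom_eq_qMultichoose q (α + β) _ j (by ring)
  have hii (n N : ℕ) (hN : (N : ℝ) = (n : ℝ) + α + β) :
      (bsemPoly q α β n : ℝ⟦X⟧) * (qPochSeries q N)⁻¹ =
        PowerSeries.mk fun j : ℕ => qMultichoose q (α + β) j * qReal q ((j : ℝ) + β) ^ n := by
    rw [qPochSeries_inv hq0 hq1, hN, bsemPoly_mul_qBinomSeries hq0 hq1]
  simp only [hB]
  refine ⟨fun n hn => ?_, fun hq n x hx => hasSum_qMultichoose_mul_qReal_pow hq0 hq α β n hx,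
    hii, fun hq x t hx => exists_hasSum_exp_generating hq0 hq α β t hx, fun m hm j => ?_,
    fun n j => ?_, fun n k => ?_⟩
  · obtain ⟨n, rfl⟩ := Nat.exists_eq_add_of_le' hn
    simpa using bsemPoly_succ hq0 α β n
  · ext n
    rw [PowerSeries.coeff_mk, hii n (n + m) (by push_cast; rw [hm]; ring), PowerSeries.coeff_C_mul,
      PowerSeries.coeff_rescale, PowerSeries.coeff_exp]
    simp only [PowerSeries.coeff_mk, map_div₀, map_one, map_natCast]
    ring
  · rw [← sum_qMultichoose_mul_bsemCoeff hq0 hq1]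
    refine Finset.sum_congr rfl fun k hk => ?_
    rw [qBinom_eq_qMultichoose q ((n : ℝ) + α + β)]
    rw [Nat.cast_sub (Finset.mem_range_succ_iff.mp hk)]
    ring
  · rw [bsemCoeff_eq_sum hq0 hq1]
    refine Finset.sum_congr rfl fun j _ => ?_
    rw [add_comm (j : ℝ) β]
    ring
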